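/- Let $n\ge 2$, and for a tree $T$ let $\varphi(T)$ denote the number of non-empty subtrees of $T$. The trees of order $n$ with matching number $\beta$ exist exactly when $1\le\beta\le n/2$. For such $\beta$ let $\pi=(n-\beta,2,\dots,2,1,\dots,1)$, where the first entry is followed by $\beta-1$ twos and then $n-\beta$ ones. Let $T^*_\pi$ be the tree built from $\pi=(d_0,\dots,d_{n-1})$ by breadth-first search: the root $v_0$ gets $d_0$ children and then, in the order in which the vertices were created, each vertex $v_i$ with $i\ge 1$ gets $d_i-1$ new children. Then $T^*_\pi$ is a tree of order $n$ with matching number $\beta$ and degree sequence $\pi$; it is (up to isomorphism) the tree obtained from the star $K_{1,n-\beta}$ by adding one pendant edge at each of $\beta-1$ of its leaves; and, up to isomorphism, it is the unique tree with the largest number of subtrees among all trees of order $n$ with matching number $\beta$. Moreover, for every tree $T$ of order $n$ with matching number $\beta$, $$\varphi(T)\le 2^{\,n-2\beta+1}\,3^{\,\beta-1}+n+\beta-2,$$ with equality if and only if $T$ is isomorphic to $T^*_\pi$. -/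

import Mathlib

/-- The number `φ(T)` of (non-empty) subtrees of `T`: subgraphs that are trees. -/
noncomputable def numSubtrees {V : Type*} (T : SimpleGraph V) : ℕ :=
  Nat.card {H : T.Subgraph // H.coe.IsTree}

/-- The matching number: the largest number of edges of a matching of `G` (`V` finite). -/
noncomputable def matchingNumber {V : Type*} (G : SimpleGraph V) : ℕ :=
  ⨆ M : {M : G.Subgraph // M.IsMatching}, M.1.edgeSet.ncard

/-- The degree sequence of a finite graph: its vertex degrees in nonincreasing order. -/
noncomputable def degreeSequence {V : Type*} [Fintype V] (G : SimpleGraph V) : List ℕ :=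
  ((Finset.univ : Finset V).val.map fun v => (G.neighborSet v).ncard).sort (· ≥ ·)

/-- `T` is a tree of order `n` with matching number `β`. -/
def IsTreeWithMatchingNumber (n β : ℕ) {V : Type*} (T : SimpleGraph V) : Prop :=
  Nat.card V = n ∧ T.IsTree ∧ matchingNumber T = β

/-- `T` has the largest number of subtrees among the trees of order `n` with matching
number `β`. (Up to isomorphism all of these live on the vertex type `V` of `T`.) -/
def IsOptimal (n β : ℕ) {V : Type*} (T : SimpleGraph V) : Prop :=
  IsTreeWithMatchingNumber n β T ∧
    ∀ T' : SimpleGraph V, IsTreeWithMatchingNumber n β T' → numSubtrees T' ≤ numSubtrees T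

/-- The number of children of vertex `i` in the breadth-first tree with degrees `d`: the
root `0` has `d₀` children, every other vertex `i` has `dᵢ - 1`. -/
def bfsChildren (d : List ℕ) (i : ℕ) : ℕ :=
  if i = 0 then d.getD 0 0 else d.getD i 0 - 1

/-- `j` is a child of `i` when vertices are numbered `0, 1, 2, …` in the order of their
discovery: the root is `0` and the children of `i` come right after those of `0, …, i - 1`. -/
def IsBfsChild (d : List ℕ) (i j : ℕ) : Prop :=
  1 + ∑ k ∈ Finset.range i, bfsChildren d k ≤ j ∧
    j < 1 + ∑ k ∈ Finset.range (i + 1), bfsChildren d k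

/-- The tree `T*_d` built by breadth-first search from the degree sequence `d`. -/
def bfsTree (d : List ℕ) : SimpleGraph (Fin d.length) :=
  SimpleGraph.fromRel fun i j => IsBfsChild d i j

/-- The star `K_{1,a}` with a pendant edge added at each of `b` of its leaves (`b ≤ a`):
the centre is `inl ()`, the `i`-th leaf of the star is `inr (inl i)`, and the `j`-th added
vertex `inr (inr j)` is joined to the `j`-th leaf. -/
def pendantStar (a b : ℕ) : SimpleGraph (Unit ⊕ (Fin a ⊕ Fin b)) :=
  SimpleGraph.fromRel fun x y =>
    match x, y with
    | Sum.inl _, Sum.inr (Sum.inl _) => True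
    | Sum.inr (Sum.inl i), Sum.inr (Sum.inr j) => (i : ℕ) = (j : ℕ)
    | _, _ => False

/-- The sequence `(n - β, 2, …, 2, 1, …, 1)` with `β - 1` twos followed by `n - β` ones. -/
def matchingDegrees (n β : ℕ) : List ℕ :=
  (n - β) :: (List.replicate (β - 1) 2 ++ List.replicate (n - β) 1)

/-! In an acyclic graph a subtree is determined by its vertex set, so `numSubtrees` counts non-empty
connected vertex sets (`numSubtrees_eq_connCount`). Put `a = n - β` and `b = β - 1`. The extremal
tree is the spider with `a` legs, `b` of length two and the rest of length one: `2 ^ (a - b) * 3 ^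
b` subtrees contain its centre and `a + 2 * b` avoid it.

The bound is an induction on the order. A tree with at least three vertices has two leaves at a
common neighbour or a pendant path of two edges, even away from a prescribed vertex
(`RootedTree.cases`). Deleting one of two twin leaves keeps the matching number; deleting such a
path lowers it by at most one (`HasMatching.of_twins`, `HasMatching.of_path`). Conversely, attaching
a leaf at `u` adds one plus the number of subtrees through `u`, and attaching a path at `w` adds
three plus twice the number through `w`.

Hence subtrees through a given vertex must be bounded too. A leaf at most doubles their number and a
path at most triples it, with equality only for attachment at that vertex (`RootedTree.rootBound`).
Feeding this into the additive recursion gives `RootedTree.totalBound`. Equality propagates back to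
a spider centred at the attachment vertex (or to the path on three vertices, also a spider), and
spiders with equal parameters are isomorphic (`Spider.nonempty_iso`). -/

namespace SubtreeCount
open SimpleGraph

/-! ### Counting connected vertex sets by removing pendant vertices -/

variable {V : Type*} {G : SimpleGraph V} {W S X : Finset V} {u v w x : V}

/-- The vertex set `S` induces a connected subgraph of `G`. -/
def Conn (G : SimpleGraph V) (S : Finset V) : Prop := (G.induce (S : Set V)).Connected

/-- The connected vertex sets between `X` and `W`. -/
noncomputable def connSets (G : SimpleGraph V) (W X : Finset V) : Finset (Finset V) :=
  @Finset.filter _ (fun S => X ⊆ S ∧ Conn G S) (Classical.decPred _) W.powerset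

/-- The number of connected vertex sets between `X` and `W`. -/
noncomputable def connCount (G : SimpleGraph V) (W X : Finset V) : ℕ := (connSets G W X).card

lemma mem_connSets : S ∈ connSets G W X ↔ S ⊆ W ∧ X ⊆ S ∧ Conn G S := by
  simp [connSets]

/-- The vertex `v` lies outside `W` and its only neighbour in `W` is `u`. -/
structure Pendant (G : SimpleGraph V) (W : Finset V) (v u : V) : Prop where
  notMem : v ∉ W
  mem : u ∈ W
  adj : ∀ y ∈ W, G.Adj v y ↔ y = u

lemma Conn.nonempty (h : Conn G S) : S.Nonempty := by
  obtain ⟨z, hz⟩ := SimpleGraph.Connected.nonempty h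
  exact ⟨z, hz⟩

lemma conn_singleton (G : SimpleGraph V) (x : V) : Conn G {x} := by
  unfold Conn
  rw [Finset.coe_singleton]
  have : Subsingleton ({x} : Set V) := Set.subsingleton_coe _ |>.2 Set.subsingleton_singleton
  exact (IsTree.of_subsingleton).1

lemma connCount_singleton_singleton (G : SimpleGraph V) (x : V) : connCount G {x} {x} = 1 := by
  classical
  unfold connCount
  rw [Finset.card_eq_one]
  refine ⟨{x}, ?_⟩
  ext S
  simp only [mem_connSets, Finset.mem_singleton]
  constructor
  · rintro ⟨h1, h2, -⟩
    exact h1.antisymm h2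
  · rintro rfl
    exact ⟨subset_rfl, subset_rfl, conn_singleton G x⟩

lemma connCount_singleton_empty (G : SimpleGraph V) (x : V) : connCount G {x} ∅ = 1 := by
  rw [← connCount_singleton_singleton G x]
  classical
  unfold connCount
  congr 1
  ext S
  simp only [mem_connSets, Finset.empty_subset, true_and]
  constructor
  · rintro ⟨h1, h2⟩
    refine ⟨h1, ?_, h2⟩
    rw [(Finset.Nonempty.subset_singleton_iff h2.nonempty).1 h1]
  · tauto

lemma connCount_anti {Y : Finset V} (h : X ⊆ Y) : connCount G W Y ≤ connCount G W X := by
  classical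
  refine Finset.card_le_card ?_
  intro S
  simp only [mem_connSets]
  rintro ⟨h1, h2, h3⟩
  exact ⟨h1, h.trans h2, h3⟩

variable [DecidableEq V]

/-- The vertex `v` meets the rest only through `u`, and deleting a vertex with a single neighbour
cannot disconnect what remains. -/
lemma Pendant.conn_insert_iff (h : Pendant G W v u) (hS : S ⊆ W) :
    Conn G (insert v S) ↔ S = ∅ ∨ (u ∈ S ∧ Conn G S) := by
  have hv : v ∉ S := fun hv => h.notMem (hS hv)
  constructor
  · intro hc
    rcases S.eq_empty_or_nonempty with h0 | ⟨z, hz⟩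
    · exact Or.inl h0
    refine Or.inr ?_
    have hnb : ∀ y ∈ insert v S, G.Adj v y → y = u ∧ u ∈ S := by
      intro y hy hvy
      rcases Finset.mem_insert.1 hy with rfl | hy
      · exact absurd hvy (G.loopless.irrefl _)
      · have := (h.adj y (hS hy)).1 hvy
        exact ⟨this, this ▸ hy⟩
    constructor
    · have : Nontrivial ((insert v S : Finset V) : Set V) :=
        ⟨⟨v, by simp⟩, ⟨z, by simp [hz]⟩, by rintro ⟨⟩; exact hv hz⟩
      obtain ⟨⟨y, hy⟩, hvy⟩ := hc.preconnected.exists_adj_of_nontrivial ⟨v, by simp⟩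
      exact (hnb y hy hvy).2
    · have hpre := hc.preconnected.induce_of_degree_eq_one
        (s := {y | (y : V) ∈ S}) (by
          rintro ⟨y, hy⟩ hyS ⟨p, hp⟩ hpa ⟨q, hq⟩ hqa
          have : y = v := by
            simp only [Finset.coe_insert, Set.mem_insert_iff] at hy
            exact hy.resolve_right hyS
          subst this
          exact Subtype.ext ((hnb p hp hpa).1.trans (hnb q hq hqa).1.symm))
      refine (connected_iff _).2 ⟨?_, ⟨z, hz⟩⟩
      refine hpre.map (f := ⟨fun y => ⟨y.1.1, y.2⟩, fun h => h⟩) ?_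
      rintro ⟨y, hy⟩
      exact ⟨⟨⟨y, by simp [show y ∈ S from hy]⟩, hy⟩, rfl⟩
  · rintro (rfl | ⟨hu, hc⟩)
    · simpa using conn_singleton G v
    · have h2 : (G.induce {v, u}).Connected :=
        induce_pair_connected_of_adj ((h.adj u h.mem).2 rfl)
      have hset : ((insert v S : Finset V) : Set V) = {v, u} ∪ (S : Set V) := by
        ext y
        simp only [Finset.coe_insert, Set.mem_insert_iff, Finset.mem_coe, Set.mem_union,
          Set.mem_singleton_iff]
        constructor
        · tauto
        · rintro ((rfl | rfl) | h) <;> tauto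
      unfold Conn
      rw [hset]
      exact induce_union_connected h2.preconnected hc.preconnected ⟨u, by simp, hu⟩

lemma connCount_insert (hv : v ∉ W) :
    connCount G (insert v W) X = connCount G W X + connCount G (insert v W) (insert v X) := by
  classical
  unfold connCount
  rw [← Finset.card_filter_add_card_filter_not (s := connSets G (insert v W) X) (fun S => v ∉ S)]
  congr 2
  · ext S
    simp only [Finset.mem_filter, mem_connSets]
    constructor
    · rintro ⟨⟨h1, h2⟩, h3⟩
      exact ⟨(Finset.subset_insert_iff_of_notMem h3).1 h1, h2⟩
    · rintro ⟨h1, h2⟩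
      exact ⟨⟨h1.trans (Finset.subset_insert _ _), h2⟩, fun h => hv (h1 h)⟩
  · ext S
    simp only [Finset.mem_filter, mem_connSets, Finset.insert_subset_iff]
    tauto

/-- Erasing `v` leaves either a connected set through `u` or nothing; the latter comes from `{v}`,
which is admissible only for `X = ∅`. -/
lemma Pendant.connCount_insert_insert (h : Pendant G W v u) (hX : v ∉ X) :
    connCount G (insert v W) (insert v X) =
      (if X = ∅ then 1 else 0) + connCount G W (insert u X) := by
  classical
  have key : connSets G (insert v W) (insert v X) =
      (W.powerset.filter fun S => X ⊆ S ∧ (S = ∅ ∨ (u ∈ S ∧ Conn G S))).image (insert v) := by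
    ext S
    simp only [mem_connSets, Finset.mem_filter, Finset.mem_powerset, Finset.mem_image]
    constructor
    · rintro ⟨h1, h2, h3⟩
      have hvS : v ∈ S := h2 (Finset.mem_insert_self _ _)
      have hsub : S.erase v ⊆ W := by rwa [← Finset.subset_insert_iff]
      refine ⟨S.erase v, ⟨hsub, ?_, ?_⟩, Finset.insert_erase hvS⟩
      · intro z hz
        exact Finset.mem_erase.2 ⟨fun h => hX (h ▸ hz), h2 (Finset.mem_insert_of_mem hz)⟩
      · rw [← h.conn_insert_iff hsub, Finset.insert_erase hvS]
        exact h3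
    · rintro ⟨S, ⟨h1, h2, h3⟩, rfl⟩
      exact ⟨Finset.insert_subset_insert _ h1, Finset.insert_subset_insert _ h2,
        (h.conn_insert_iff h1).2 h3⟩
  unfold connCount
  rw [key, Finset.card_image_of_injOn]
  · rw [← Finset.card_filter_add_card_filter_not (s := W.powerset.filter _) (fun S => S = ∅),
      Finset.filter_filter, Finset.filter_filter]
    congr 1
    · split_ifs with hX0
      · rw [Finset.card_eq_one]
        refine ⟨∅, ?_⟩
        ext S
        simp only [Finset.mem_filter, Finset.mem_powerset, Finset.mem_singleton]
        constructor
        · tauto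
        · rintro rfl
          simp [hX0]
      · rw [Finset.card_eq_zero]
        ext S
        simp only [Finset.mem_filter, Finset.mem_powerset, Finset.notMem_empty, iff_false]
        rintro ⟨-, ⟨h1, -⟩, rfl⟩
        exact hX0 (Finset.subset_empty.1 h1)
    · congr 1
      ext S
      simp only [mem_connSets, Finset.mem_filter, Finset.mem_powerset, Finset.insert_subset_iff]
      constructor
      · tauto
      · rintro ⟨h1, ⟨h2, h3⟩, h4⟩
        exact ⟨h1, ⟨h3, Or.inr ⟨h2, h4⟩⟩, Finset.ne_empty_of_mem h2⟩
  · intro S hS S' hS' hSS'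
    simp only [Finset.coe_filter, Finset.mem_powerset, Set.mem_ofPred_eq] at hS hS'
    have e1 : v ∉ S := fun hv => h.notMem (hS.1 hv)
    have e2 : v ∉ S' := fun hv => h.notMem (hS'.1 hv)
    rw [← Finset.erase_insert e1, ← Finset.erase_insert e2]
    exact congrArg (Finset.erase · v) hSS'

/-- The set `{x}` is counted on the right, so under equality it contains `u`. This locates the
attachment vertex in the equality cases. -/
lemma eq_of_connCount_pair_eq (hx : x ∈ W) (h : connCount G W {u, x} = connCount G W {x}) :
    u = x := by
  have hsub : connSets G W {u, x} ⊆ connSets G W {x} := by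
    intro S
    simp only [mem_connSets]
    rintro ⟨h1, h2, h3⟩
    exact ⟨h1, (Finset.subset_insert _ _).trans h2, h3⟩
  have hm : ({x} : Finset V) ∈ connSets G W {x} :=
    mem_connSets.2 ⟨Finset.singleton_subset_iff.2 hx, subset_rfl, conn_singleton G x⟩
  rw [← Finset.eq_of_subset_of_card_le hsub h.ge] at hm
  exact Finset.mem_singleton.1 ((mem_connSets.1 hm).2.1 (Finset.mem_insert_self u _))

lemma Pendant.connCount_root (h : Pendant G W v u) (hx : x ∈ W) :
    connCount G (insert v W) {x} = connCount G W {x} + connCount G W {u, x} := by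
  have hvx : v ∉ ({x} : Finset V) := by
    rw [Finset.mem_singleton]
    rintro rfl
    exact h.notMem hx
  rw [connCount_insert h.notMem, h.connCount_insert_insert hvx,
    if_neg (Finset.singleton_ne_empty x), zero_add]

lemma Pendant.connCount_empty (h : Pendant G W v u) :
    connCount G (insert v W) ∅ = connCount G W ∅ + 1 + connCount G W {u} := by
  rw [connCount_insert h.notMem,
    h.connCount_insert_insert (Finset.notMem_empty v), if_pos rfl, ← add_assoc]
  rfl

lemma connCount_path_root (hu : Pendant G W u w) (hv : Pendant G (insert u W) v u) (hx : x ∈ W) :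
    connCount G (insert v (insert u W)) {x} = connCount G W {x} + 2 * connCount G W {w, x} := by
  have hux : u ∉ ({x} : Finset V) := by
    rw [Finset.mem_singleton]
    rintro rfl
    exact hu.notMem hx
  rw [hv.connCount_root (Finset.mem_insert_of_mem hx), hu.connCount_root hx,
    hu.connCount_insert_insert hux, if_neg (Finset.singleton_ne_empty x)]
  ring

/-- The three sets missing `W` are `{u}`, `{v}` and `{u, v}`; a connected set through `w` extends by
`u` alone or by both. -/
lemma connCount_path_empty (hu : Pendant G W u w) (hv : Pendant G (insert u W) v u) :
    connCount G (insert v (insert u W)) ∅ = connCount G W ∅ + 3 + 2 * connCount G W {w} := by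
  have := hu.connCount_insert_insert (Finset.notMem_empty u)
  rw [if_pos rfl] at this
  rw [hv.connCount_empty, hu.connCount_empty]
  simp only [insert_empty_eq] at this ⊢
  rw [this]
  ring

end SubtreeCount

/-! ### Matchings under deletion, and trees grown leaf by leaf -/

namespace SubtreeCount
open SimpleGraph

variable {V : Type*} {G : SimpleGraph V} {W : Finset V} {s t u v w x y : V} {a b k : ℕ}

/-- `W` contains the vertex set of a matching of `G` with at least `k` edges. -/
def HasMatching (G : SimpleGraph V) (W : Finset V) (k : ℕ) : Prop :=
  ∃ M : Finset (Sym2 V), k ≤ M.card ∧ (∀ e ∈ M, e ∈ G.edgeSet ∧ ∀ y ∈ e, y ∈ W) ∧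
    ∀ e ∈ M, ∀ f ∈ M, ∀ y, y ∈ e → y ∈ f → e = f

lemma HasMatching.mono {W' : Finset V} (h : HasMatching G W k) (hW : W ⊆ W') :
    HasMatching G W' k := by
  obtain ⟨M, h1, h2, h3⟩ := h
  exact ⟨M, h1, fun e he => ⟨(h2 e he).1, fun y hy => hW ((h2 e he).2 y hy)⟩, h3⟩

lemma hasMatching_zero (G : SimpleGraph V) (W : Finset V) : HasMatching G W 0 :=
  ⟨∅, by simp⟩

lemma Pendant.singleton (h : G.Adj v u) : Pendant G {u} v u :=
  ⟨by simpa using h.ne, by simp, by simpa using h⟩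

variable [DecidableEq V]

lemma HasMatching.insert_pair (h : HasMatching G W k) (hs : s ∉ W) (ht : t ∉ W)
    (hst : G.Adj s t) : HasMatching G (insert s (insert t W)) (k + 1) := by
  obtain ⟨M, h1, h2, h3⟩ := h
  have hd : ∀ e ∈ M, ∀ y ∈ e, y ∉ s(s, t) := by
    intro e he y hy hy'
    have := (h2 e he).2 y hy
    rcases Sym2.mem_iff.1 hy' with rfl | rfl
    · exact hs this
    · exact ht this
  refine ⟨insert s(s, t) M, ?_, ?_, ?_⟩
  · rw [Finset.card_insert_of_notMem]
    · omega
    · exact fun hm => hd _ hm s (Sym2.mem_mk_left _ _) (Sym2.mem_mk_left _ _)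
  · intro e he
    rcases Finset.mem_insert.1 he with rfl | he
    · refine ⟨hst, fun y hy => ?_⟩
      rcases Sym2.mem_iff.1 hy with rfl | rfl <;> simp
    · exact ⟨(h2 e he).1, fun y hy =>
        Finset.mem_insert_of_mem (Finset.mem_insert_of_mem ((h2 e he).2 y hy))⟩
  · intro e he f hf y hye hyf
    rcases Finset.mem_insert.1 he with rfl | he <;> rcases Finset.mem_insert.1 hf with rfl | hf
    · rfl
    · exact absurd hye (hd f hf y hyf)
    · exact absurd hyf (hd e he y hye)
    · exact h3 e he f hf y hye hyf

lemma HasMatching.two_mul_le_card (h : HasMatching G W k) : 2 * k ≤ W.card := by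
  obtain ⟨M, h1, h2, h3⟩ := h
  have hdis : (M : Set (Sym2 V)).PairwiseDisjoint Sym2.toFinset := by
    intro e he f hf hef
    rw [Function.onFun, Finset.disjoint_left]
    intro y hy hy'
    exact hef (h3 e he f hf y (Sym2.mem_toFinset.1 hy) (Sym2.mem_toFinset.1 hy'))
  have hsub : M.biUnion Sym2.toFinset ⊆ W := by
    intro y hy
    obtain ⟨e, he, hy⟩ := Finset.mem_biUnion.1 hy
    exact (h2 e he).2 y (Sym2.mem_toFinset.1 hy)
  have hcard := Finset.card_le_card hsub
  rw [Finset.card_biUnion hdis, Finset.sum_congr rfl (g := fun _ => 2), Finset.sum_const,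
    smul_eq_mul] at hcard
  · omega
  · intro e he
    exact Sym2.card_toFinset_of_not_isDiag e (G.not_isDiag_of_mem_edgeSet (h2 e he).1)

/-- Within the set, every edge at `v` or `s` ends at `u`, so a matching covers at most one of them
and the other can be deleted. -/
lemma HasMatching.of_twins (h : HasMatching G (insert v (insert s W)) k)
    (hv : Pendant G (insert s W) v u) (hs : Pendant G W s u) :
    HasMatching G (insert v W) k ∨ HasMatching G (insert s W) k := by
  obtain ⟨M, h1, h2, h3⟩ := h
  have hvs : v ≠ s := by
    rintro rfl
    exact hv.notMem (Finset.mem_insert_self _ _)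
  have main : ∀ y z : V, (∀ e ∈ M, ∀ q ∈ e, q ∈ insert y (insert z W)) → (∀ e ∈ M, y ∉ e) →
      HasMatching G (insert z W) k := by
    intro y z hM hy
    refine ⟨M, h1, fun e he => ⟨(h2 e he).1, fun q hq => ?_⟩, h3⟩
    refine (Finset.mem_insert.1 (hM e he q hq)).resolve_left ?_
    rintro rfl
    exact hy e he hq
  have edge : ∀ y, (∀ q ∈ insert v (insert s W), G.Adj y q → q = u) →
      ∀ e ∈ M, y ∈ e → u ∈ e ∧ e = s(y, u) := by
    intro y hy e he hye
    obtain ⟨q, rfl⟩ := hye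
    have := h2 _ he
    have hq := hy q (this.2 q (Sym2.mem_mk_right _ _)) this.1
    subst hq
    exact ⟨Sym2.mem_mk_right _ _, rfl⟩
  have nv : ∀ q ∈ insert v (insert s W), G.Adj v q → q = u := by
    intro q hq hvq
    rcases Finset.mem_insert.1 hq with rfl | hq
    · exact absurd hvq (G.loopless.irrefl _)
    · exact (hv.adj q hq).1 hvq
  have nsv : ¬ G.Adj v s := fun h => hs.notMem
    ((hv.adj s (Finset.mem_insert_self _ _)).1 h ▸ hs.mem)
  have ns : ∀ q ∈ insert v (insert s W), G.Adj s q → q = u := by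
    intro q hq hsq
    rcases Finset.mem_insert.1 hq with rfl | hq
    · exact absurd hsq.symm nsv
    rcases Finset.mem_insert.1 hq with rfl | hq
    · exact absurd hsq (G.loopless.irrefl _)
    · exact (hs.adj q hq).1 hsq
  by_cases hvM : ∃ e ∈ M, v ∈ e
  · left
    obtain ⟨e, he, hve⟩ := hvM
    obtain ⟨hue, rfl⟩ := edge v nv e he hve
    have hsM : ∀ f ∈ M, s ∉ f := by
      intro f hf hsf
      obtain ⟨huf, rfl⟩ := edge s ns f hf hsf
      have := h3 _ he _ hf u hue huf
      have hvu : v ≠ u := fun h => hv.notMem (h ▸ hv.mem)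
      have hmem : v ∈ s(s, u) := this ▸ Sym2.mem_mk_left v u
      rcases Sym2.mem_iff.1 hmem with h | h
      · exact hvs h
      · exact hvu h
    refine main s v ?_ hsM
    rw [Finset.insert_comm]
    exact fun e he => (h2 e he).2
  · right
    exact main v s (fun e he => (h2 e he).2) (fun e he hve => hvM ⟨e, he, hve⟩)

/-- At most one matching edge contains `u`, and an edge at `v` contains `u`; dropping that edge
frees both vertices. -/
lemma HasMatching.of_path (h : HasMatching G (insert v (insert u W)) (k + 1))
    (hv : Pendant G (insert u W) v u) : HasMatching G W k := by
  obtain ⟨M, h1, h2, h3⟩ := h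
  refine ⟨M.filter (u ∉ ·), ?_, ?_, ?_⟩
  · have hle : (M.filter (¬ u ∉ ·)).card ≤ 1 := by
      rw [Finset.card_le_one]
      intro e he f hf
      simp only [not_not, Finset.mem_filter] at he hf
      exact h3 e he.1 f hf.1 u he.2 hf.2
    have := Finset.card_filter_add_card_filter_not (s := M) (u ∉ ·)
    omega
  · intro e he
    obtain ⟨he, hue⟩ := Finset.mem_filter.1 he
    refine ⟨(h2 e he).1, fun y hy => ?_⟩
    rcases Finset.mem_insert.1 ((h2 e he).2 y hy) with rfl | hyW
    · exfalso
      obtain ⟨q, rfl⟩ := hy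
      have hadj : G.Adj y q := (h2 _ he).1
      rcases Finset.mem_insert.1 ((h2 _ he).2 q (Sym2.mem_mk_right _ _)) with rfl | hq
      · exact G.loopless.irrefl _ hadj
      · exact hue ((hv.adj q hq).1 hadj ▸ Sym2.mem_mk_right _ _)
    · refine (Finset.mem_insert.1 hyW).resolve_left ?_
      rintro rfl
      exact hue hy
  · intro e he f hf
    exact h3 e (Finset.mem_filter.1 he).1 f (Finset.mem_filter.1 hf).1

/-- `W` is the vertex set of a tree built from the root `x` by successively attaching leaves. -/
inductive RootedTree (G : SimpleGraph V) (x : V) : Finset V → Prop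
  | root : RootedTree G x {x}
  | attach {W : Finset V} {v u : V} :
    RootedTree G x W → Pendant G W v u → RootedTree G x (insert v W)

lemma RootedTree.root_mem (h : RootedTree G x W) : x ∈ W := by
  induction h with
  | root => simp
  | attach _ _ ih => exact Finset.mem_insert_of_mem ih

lemma Pendant.restrict (h : Pendant G (insert s W) v u) (hu : u ∈ W) : Pendant G W v u :=
  ⟨fun hv => h.notMem (Finset.mem_insert_of_mem hv), hu,
    fun y hy => h.adj y (Finset.mem_insert_of_mem hy)⟩

lemma Pendant.extend (h : Pendant G W v u) (hs : s ≠ v) (hvs : ¬ G.Adj v s) :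
    Pendant G (insert s W) v u := by
  refine ⟨?_, Finset.mem_insert_of_mem h.mem, ?_⟩
  · rw [Finset.mem_insert, not_or]
    exact ⟨hs.symm, h.notMem⟩
  · intro y hy
    rcases Finset.mem_insert.1 hy with rfl | hy
    · refine ⟨fun h => absurd h hvs, ?_⟩
      rintro rfl
      exact (h.adj _ h.mem).2 rfl
    · exact h.adj y hy

/-- Two pendant vertices attached one after the other, the second not at the first, commute. -/
lemma Pendant.comm (hv : Pendant G W v u) (hs : Pendant G (insert v W) s t) (ht : t ≠ v) :
    Pendant G W s t ∧ Pendant G (insert s W) v u := by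
  have htW : t ∈ W := (Finset.mem_insert.1 hs.mem).resolve_left ht
  refine ⟨hs.restrict htW, hv.extend ?_ ?_⟩
  · rintro rfl
    exact hs.notMem (Finset.mem_insert_self _ _)
  · intro h
    exact ht ((hs.adj v (Finset.mem_insert_self _ _)).1 h.symm).symm

/-- Start from `v`, attach the old root `u`, then attach the other leaves in their old order: none
of them hangs from `v`. -/
lemma RootedTree.insert_root (h : RootedTree G u W) (hv : Pendant G W v u) :
    RootedTree G v (insert v W) := by
  induction h with
  | root =>
    rw [Finset.pair_comm]
    exact .attach .root (.singleton (((hv.adj u hv.mem).2 rfl).symm))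
  | @attach W s t hW hs ih =>
    have hu := hW.root_mem
    have hus : u ≠ s := by
      rintro rfl
      exact hs.notMem hu
    obtain ⟨h1, h2⟩ := hs.comm hv hus
    rw [Finset.insert_comm]
    exact .attach (ih h1) h2

/-- Needed because the total count uses the root bound at whichever vertex the deleted piece was
attached to. -/
lemma RootedTree.change_root (h : RootedTree G x W) (hy : y ∈ W) : RootedTree G y W := by
  induction h generalizing y with
  | root =>
    rw [Finset.mem_singleton.1 hy]
    exact .root
  | attach hW hv ih =>
    rcases Finset.mem_insert.1 hy with rfl | hy
    · exact (ih hv.mem).insert_root hv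
    · exact .attach (ih hy) hv

/-- A rooted tree is a point, an edge, or has two leaves attached at the same vertex or a path of
two edges attached, away from the root. -/
lemma RootedTree.cases (h : RootedTree G x W) :
    W = {x} ∨ (∃ v, W = insert v {x} ∧ Pendant G {x} v x) ∨
    (∃ W' u v s, W = insert v (insert s W') ∧ RootedTree G x W' ∧ Pendant G W' s u ∧
      Pendant G (insert s W') v u) ∨
    ∃ W' w u v, W = insert v (insert u W') ∧ RootedTree G x W' ∧ Pendant G W' u w ∧
      Pendant G (insert u W') v u := by
  induction h with
  | root => exact Or.inl rfl
  | @attach W p q hW hp ih =>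
    refine Or.inr ?_
    rcases ih with rfl | ⟨v, rfl, hv⟩ | ⟨W', u, v, s, rfl, hW', hs, hv⟩ |
        ⟨W', w, u, v, rfl, hW', hu, hv⟩
    · left
      have := Finset.mem_singleton.1 hp.mem
      subst this
      exact ⟨p, rfl, hp⟩
    · right
      by_cases hq : q = v
      · subst hq
        exact Or.inr ⟨_, _, _, _, rfl, .root, hv, hp⟩
      · have := Finset.mem_singleton.1 ((Finset.mem_insert.1 hp.mem).resolve_left hq)
        subst this
        exact Or.inl ⟨_, _, _, _, rfl, .root, hv, hp⟩
    · right
      obtain ⟨hv', hs'⟩ := hs.comm hv (by rintro rfl; exact hs.notMem hs.mem)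
      -- A new leaf on one of the twins forms a path of two edges with it; elsewhere it commutes
      -- past both twins into `W'`.
      by_cases hqv : q = v
      · subst hqv
        right
        refine ⟨insert s W', u, q, p, rfl, .attach hW' hs, hv, hp⟩
      by_cases hqs : q = s
      · subst hqs
        right
        refine ⟨insert v W', u, q, p, ?_, .attach hW' hv', hs', ?_⟩
        · rw [Finset.insert_comm v q]
        · rwa [Finset.insert_comm q v]
      left
      obtain ⟨hp1, hv1⟩ := hv.comm hp hqv
      obtain ⟨hp2, hs2⟩ := hs.comm hp1 hqs
      refine ⟨insert p W', u, v, s, ?_, .attach hW' hp2, hs2, ?_⟩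
      · rw [Finset.insert_comm p v, Finset.insert_comm p s]
      · rwa [Finset.insert_comm s p]
    · right
      by_cases hqv : q = v
      · subst hqv
        right
        exact ⟨insert u W', u, q, p, rfl, .attach hW' hu, hv, hp⟩
      obtain ⟨hp1, hv1⟩ := hv.comm hp hqv
      -- A new leaf at the middle of the path is a twin of its end `v`.
      by_cases hqu : q = u
      · subst hqu
        left
        exact ⟨insert q W', q, p, v, rfl, .attach hW' hu, hv, hp⟩
      right
      obtain ⟨hp2, hu2⟩ := hu.comm hp1 hqu
      refine ⟨insert p W', w, u, v, ?_, .attach hW' hp2, hu2, ?_⟩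
      · rw [Finset.insert_comm p v, Finset.insert_comm p u]
      · rwa [Finset.insert_comm u p]

end SubtreeCount

/-! ### Spiders and the extremal bounds -/

namespace SubtreeCount
open SimpleGraph

variable {V : Type*} [DecidableEq V] {G : SimpleGraph V} {W : Finset V} {s t u v w x y : V}
  {a b k : ℕ}

/-- `W` is the vertex set of a spider with centre `x`, `a` legs, `b` of which have length two
and the others length one. -/
inductive Spider (G : SimpleGraph V) (x : V) : Finset V → ℕ → ℕ → Prop
  | centre : Spider G x {x} 0 0
  | leaf {W : Finset V} {a b : ℕ} {v : V} :
    Spider G x W a b → Pendant G W v x → Spider G x (insert v W) (a + 1) b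
  | path {W : Finset V} {a b : ℕ} {u v : V} :
    Spider G x W a b → Pendant G W u x → Pendant G (insert u W) v u →
      Spider G x (insert v (insert u W)) (a + 1) (b + 1)

namespace Spider

lemma le (h : Spider G x W a b) : b ≤ a := by
  induction h <;> omega

lemma centre_mem (h : Spider G x W a b) : x ∈ W := by
  induction h with
  | centre => simp
  | leaf _ _ ih => exact Finset.mem_insert_of_mem ih
  | path _ _ _ ih => exact Finset.mem_insert_of_mem (Finset.mem_insert_of_mem ih)

lemma card (h : Spider G x W a b) : W.card = a + b + 1 := by
  induction h with
  | centre => simp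
  | leaf _ hv ih => rw [Finset.card_insert_of_notMem hv.notMem, ih]; ring
  | path _ hu hv ih =>
    rw [Finset.card_insert_of_notMem hv.notMem, Finset.card_insert_of_notMem hu.notMem, ih]; ring

/-- A set through the centre meets a leg of length one in two ways and a leg of length two in three,
independently. -/
lemma connCount_root (h : Spider G x W a b) : connCount G W {x} = 2 ^ (a - b) * 3 ^ b := by
  induction h with
  | centre => simpa using connCount_singleton_singleton G x
  | @leaf W a b v hW hv ih =>
    rw [hv.connCount_root hW.centre_mem, Finset.insert_eq_of_mem (Finset.mem_singleton_self x), ih,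
      show a + 1 - b = (a - b) + 1 by have := hW.le; omega]
    ring
  | @path W a b u v hW hu hv ih =>
    rw [connCount_path_root hu hv hW.centre_mem,
      Finset.insert_eq_of_mem (Finset.mem_singleton_self x), ih,
      show a + 1 - (b + 1) = a - b by omega]
    ring

/-- A connected set avoiding the centre lies in one leg, which gives `(a - b) + 3 * b` of them. -/
lemma connCount_empty (h : Spider G x W a b) :
    connCount G W ∅ = 2 ^ (a - b) * 3 ^ b + (a + 2 * b) := by
  induction h with
  | centre => simpa using connCount_singleton_empty G x
  | @leaf W a b v hW hv ih =>
    rw [hv.connCount_empty, hW.connCount_root, ih,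
      show a + 1 - b = (a - b) + 1 by have := hW.le; omega]
    ring
  | @path W a b u v hW hu hv ih =>
    rw [connCount_path_empty hu hv, hW.connCount_root, ih,
      show a + 1 - (b + 1) = a - b by omega]
    ring

/-- The outer edges of the long legs leave the centre free, so a short leg supplies one more
matching edge. -/
lemma hasMatching (h : Spider G x W a b) :
    HasMatching G (W.erase x) b ∧ (b < a → HasMatching G W (b + 1)) := by
  induction h with
  | centre => exact ⟨hasMatching_zero _ _, fun h => absurd h (lt_irrefl _)⟩
  | @leaf W a b v hW hv ih =>
    refine ⟨ih.1.mono (Finset.erase_subset_erase _ (Finset.subset_insert _ _)), fun _ => ?_⟩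
    have := ih.1.insert_pair (s := v) (t := x) (fun h => hv.notMem (Finset.mem_of_mem_erase h))
      (Finset.notMem_erase _ _) ((hv.adj x hW.centre_mem).2 rfl)
    rwa [Finset.insert_erase hW.centre_mem] at this
  | @path W a b u v hW hu hv ih =>
    have huv : G.Adj v u := (hv.adj u hv.mem).2 rfl
    have hvW : v ∉ W := fun h => hv.notMem (Finset.mem_insert_of_mem h)
    refine ⟨?_, fun hab => (ih.2 (by omega)).insert_pair hvW hu.notMem huv⟩
    refine (ih.1.insert_pair (fun h => hvW (Finset.mem_of_mem_erase h))
      (fun h => hu.notMem (Finset.mem_of_mem_erase h)) huv).mono ?_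
    intro y hy
    have hvx : v ≠ x := fun h => hvW (h ▸ hW.centre_mem)
    have hux : u ≠ x := fun h => hu.notMem (h ▸ hW.centre_mem)
    simp only [Finset.mem_insert, Finset.mem_erase] at hy ⊢
    rcases hy with rfl | rfl | hy <;> tauto

end Spider

/-- At most as many connected subsets of `W` contain `x` as in the spider with `a` legs, `b` of
which have length two, and equality forces `W` to be such a spider with centre `x`. -/
def RootBound (G : SimpleGraph V) (x : V) (W : Finset V) (a b : ℕ) : Prop :=
  connCount G W {x} ≤ 2 ^ (a - b) * 3 ^ b ∧
    (connCount G W {x} = 2 ^ (a - b) * 3 ^ b → Spider G x W a b)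

/-- At most as many non-empty connected subsets lie in `W` as in the spider with `a` legs, `b` of
which have length two, and equality forces `W` to be such a spider. -/
def TotalBound (G : SimpleGraph V) (W : Finset V) (a b : ℕ) : Prop :=
  connCount G W ∅ ≤ 2 ^ (a - b) * 3 ^ b + (a + 2 * b) ∧
    (connCount G W ∅ = 2 ^ (a - b) * 3 ^ b + (a + 2 * b) → ∃ x, Spider G x W a b)

lemma rootBound_singleton (G : SimpleGraph V) (x : V) : RootBound G x {x} 0 0 := by
  refine ⟨?_, fun _ => .centre⟩
  rw [connCount_singleton_singleton]
  simp

lemma totalBound_singleton (G : SimpleGraph V) (x : V) : TotalBound G {x} 0 0 := by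
  refine ⟨?_, fun _ => ⟨x, .centre⟩⟩
  rw [connCount_singleton_empty]
  simp

lemma RootBound.leaf (h : RootBound G x W a b) (hx : x ∈ W) (hv : Pendant G W v u) (hab : b ≤ a) :
    RootBound G x (insert v W) (a + 1) b := by
  have hle : connCount G W {u, x} ≤ connCount G W {x} := connCount_anti (Finset.subset_insert _ _)
  have hroot := hv.connCount_root hx
  have hpow : 2 ^ (a + 1 - b) * 3 ^ b = 2 * (2 ^ (a - b) * 3 ^ b) := by
    rw [show a + 1 - b = (a - b) + 1 by omega]
    ring
  have h1 := h.1
  unfold RootBound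
  rw [hpow, hroot]
  refine ⟨by omega, fun heq => ?_⟩
  have hux : u = x := eq_of_connCount_pair_eq (G := G) hx (by omega)
  subst hux
  exact .leaf (h.2 (by omega)) hv

lemma RootBound.path (h : RootBound G x W a b) (hx : x ∈ W) (hu : Pendant G W u w)
    (hv : Pendant G (insert u W) v u) : RootBound G x (insert v (insert u W)) (a + 1) (b + 1) := by
  have hle : connCount G W {w, x} ≤ connCount G W {x} := connCount_anti (Finset.subset_insert _ _)
  have hroot := connCount_path_root hu hv hx
  have hpow : 2 ^ (a + 1 - (b + 1)) * 3 ^ (b + 1) = 3 * (2 ^ (a - b) * 3 ^ b) := by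
    rw [show a + 1 - (b + 1) = a - b by omega]
    ring
  have h1 := h.1
  unfold RootBound
  rw [hpow, hroot]
  refine ⟨by omega, fun heq => ?_⟩
  have hwx : w = x := eq_of_connCount_pair_eq (G := G) hx (by omega)
  subst hwx
  exact .path (h.2 (by omega)) hu hv

/-- The path multiplies the count by at most 3 while the target grows by 4, so equality never
occurs. -/
lemma RootBound.path_zero (h : RootBound G x W a 0) (hx : x ∈ W) (hu : Pendant G W u w)
    (hv : Pendant G (insert u W) v u) : RootBound G x (insert v (insert u W)) (a + 2) 0 := by
  have hle : connCount G W {w, x} ≤ connCount G W {x} := connCount_anti (Finset.subset_insert _ _)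
  have hroot := connCount_path_root hu hv hx
  have hpow : 2 ^ (a + 2 - 0) * 3 ^ 0 = 4 * (2 ^ (a - 0) * 3 ^ 0) := by
    simp only [Nat.sub_zero]
    ring
  have hpos : 0 < 2 ^ (a - 0) * 3 ^ 0 := by positivity
  have h1 := h.1
  unfold RootBound
  rw [hpow, hroot]
  exact ⟨by omega, fun heq => by omega⟩

lemma TotalBound.leaf (h : TotalBound G W a b) (hroot : RootBound G u W a b)
    (hv : Pendant G W v u) (hab : b ≤ a) : TotalBound G (insert v W) (a + 1) b := by
  have hpow : 2 ^ (a + 1 - b) * 3 ^ b = 2 * (2 ^ (a - b) * 3 ^ b) := by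
    rw [show a + 1 - b = (a - b) + 1 by omega]
    ring
  have h1 := h.1
  have h2 := hroot.1
  unfold TotalBound
  rw [hpow, hv.connCount_empty]
  exact ⟨by omega, fun heq => ⟨u, .leaf (hroot.2 (by omega)) hv⟩⟩

lemma TotalBound.path (h : TotalBound G W a b) (hroot : RootBound G w W a b)
    (hu : Pendant G W u w) (hv : Pendant G (insert u W) v u) :
    TotalBound G (insert v (insert u W)) (a + 1) (b + 1) := by
  have hpow : 2 ^ (a + 1 - (b + 1)) * 3 ^ (b + 1) = 3 * (2 ^ (a - b) * 3 ^ b) := by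
    rw [show a + 1 - (b + 1) = a - b by omega]
    ring
  have h1 := h.1
  have h2 := hroot.1
  unfold TotalBound
  rw [hpow, connCount_path_empty hu hv]
  exact ⟨by omega, fun heq => ⟨w, .path (hroot.2 (by omega)) hu hv⟩⟩

lemma TotalBound.path_zero (h : TotalBound G W a 0) (hroot : RootBound G w W a 0)
    (hcard : W.card = a + 1) (hu : Pendant G W u w) (hv : Pendant G (insert u W) v u) :
    TotalBound G (insert v (insert u W)) (a + 2) 0 := by
  have hpow : 2 ^ (a + 2 - 0) * 3 ^ 0 = 4 * (2 ^ (a - 0) * 3 ^ 0) := by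
    simp only [Nat.sub_zero]
    ring
  have hpos : 0 < 2 ^ (a - 0) * 3 ^ 0 := by positivity
  have h1 := h.1
  have h2 := hroot.1
  unfold TotalBound
  rw [hpow, connCount_path_empty hu hv]
  -- With `X = 2 ^ a`, the count is at most `3 * X + a + 3` and the target is `4 * X + a + 2`.
  -- Equality forces `X = 1`, the path on three vertices, whose centre is `u` and not `w`.
  refine ⟨by omega, fun heq => ⟨u, ?_⟩⟩
  have hone : 2 ^ (a - 0) * 3 ^ 0 = 1 := by omega
  have ha : a = 0 := by simpa using hone
  subst ha
  obtain ⟨z, rfl⟩ := Finset.card_eq_one.1 hcard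
  obtain rfl := Finset.mem_singleton.1 hu.mem
  rw [Finset.pair_comm u w] at hv ⊢
  exact .leaf (.leaf .centre (.singleton ((hu.adj w hu.mem).2 rfl).symm)) hv

lemma HasMatching.lt (h : HasMatching G W (b + 1)) (hW : W.card = a + b + 1) : b < a := by
  have := h.two_mul_le_card
  omega

lemma HasMatching.single (hs : s ∈ W) (ht : t ∈ W) (hst : G.Adj s t) : HasMatching G W 1 := by
  refine ((hasMatching_zero G ∅).insert_pair (Finset.notMem_empty s) (Finset.notMem_empty t)
    hst).mono ?_
  simp [Finset.insert_subset_iff, hs, ht]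

lemma RootedTree.hasMatching_one (h : RootedTree G x W) (hW : 2 ≤ W.card) :
    HasMatching G W 1 := by
  cases h with
  | root => simp at hW
  | attach _ hv =>
    exact .single (Finset.mem_insert_self _ _) (Finset.mem_insert_of_mem hv.mem)
      ((hv.adj _ hv.mem).2 rfl)

/-- Only a lower bound on the matching number is assumed: this form survives the deletions of the
induction. -/
theorem RootedTree.rootBound (h : RootedTree G x W) (hM : HasMatching G W (b + 1))
    (hW : W.card = a + b + 1) : RootBound G x W a b := by
  induction hn : W.card using Nat.strong_induction_on generalizing W a b with
  | _ n ih =>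
  have hab := hM.lt hW
  rcases h.cases with rfl | ⟨v, rfl, hv⟩ | ⟨W', u, v, s, rfl, hW', hs, hv⟩ |
      ⟨W', w, u, v, rfl, hW', hu, hv⟩
  · simp at hW
    omega
  · rw [Finset.card_insert_of_notMem hv.notMem, Finset.card_singleton] at hW
    obtain rfl : b = 0 := by omega
    obtain rfl : a = 1 := by omega
    exact (rootBound_singleton G x).leaf (Finset.mem_singleton_self x) hv le_rfl
  · obtain ⟨hv', hs'⟩ := hs.comm hv (by rintro rfl; exact hs.notMem hs.mem)
    have c1 := Finset.card_insert_of_notMem hv.notMem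
    have c2 := Finset.card_insert_of_notMem hs.notMem
    have c3 := Finset.card_insert_of_notMem hv'.notMem
    obtain ⟨a, rfl⟩ : ∃ a', a = a' + 1 := ⟨a - 1, by omega⟩
    rcases hM.of_twins hv hs with hM | hM
    · have := ih _ (by omega) (.attach hW' hv') hM (a := a) (by omega) rfl
      rw [Finset.insert_comm]
      exact this.leaf (Finset.mem_insert_of_mem hW'.root_mem) hs' (by omega)
    · have := ih _ (by omega) (.attach hW' hs) hM (a := a) (by omega) rfl
      exact this.leaf (Finset.mem_insert_of_mem hW'.root_mem) hv (by omega)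
  · have c1 := Finset.card_insert_of_notMem hv.notMem
    have c2 := Finset.card_insert_of_notMem hu.notMem
    have hx := hW'.root_mem
    -- For `b = 0` the parameter cannot drop, so deleting the path costs two from `a` instead; any
    -- remaining tree with an edge still has a matching of size one.
    rcases b with _ | b
    · have hpos := Finset.card_pos.2 ⟨x, hx⟩
      obtain ⟨a, rfl⟩ : ∃ a', a = a' + 2 := ⟨a - 2, by omega⟩
      refine RootBound.path_zero ?_ hx hu hv
      rcases Nat.eq_zero_or_pos a with rfl | ha
      · obtain ⟨z, rfl⟩ := Finset.card_eq_one.1 (show W'.card = 1 by omega)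
        obtain rfl := Finset.mem_singleton.1 hx
        exact rootBound_singleton G x
      · exact ih _ (by omega) hW' (hW'.hasMatching_one (by omega)) (by omega) rfl
    · obtain ⟨a, rfl⟩ : ∃ a', a = a' + 1 := ⟨a - 1, by omega⟩
      exact (ih _ (by omega) hW' (hM.of_path hv) (by omega) rfl).path hx hu hv

theorem RootedTree.totalBound (h : RootedTree G x W) (hM : HasMatching G W (b + 1))
    (hW : W.card = a + b + 1) : TotalBound G W a b := by
  induction hn : W.card using Nat.strong_induction_on generalizing W a b with
  | _ n ih =>
  have hab := hM.lt hW
  rcases h.cases with rfl | ⟨v, rfl, hv⟩ | ⟨W', u, v, s, rfl, hW', hs, hv⟩ |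
      ⟨W', w, u, v, rfl, hW', hu, hv⟩
  · simp at hW
    omega
  · rw [Finset.card_insert_of_notMem hv.notMem, Finset.card_singleton] at hW
    obtain rfl : b = 0 := by omega
    obtain rfl : a = 1 := by omega
    exact (totalBound_singleton G x).leaf (rootBound_singleton G x) hv le_rfl
  · obtain ⟨hv', hs'⟩ := hs.comm hv (by rintro rfl; exact hs.notMem hs.mem)
    have c1 := Finset.card_insert_of_notMem hv.notMem
    have c2 := Finset.card_insert_of_notMem hs.notMem
    have c3 := Finset.card_insert_of_notMem hv'.notMem
    obtain ⟨a, rfl⟩ : ∃ a', a = a' + 1 := ⟨a - 1, by omega⟩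
    rcases hM.of_twins hv hs with hM | hM
    · have hT : RootedTree G x (insert v W') := .attach hW' hv'
      have hc : (insert v W').card = a + b + 1 := by omega
      rw [Finset.insert_comm]
      exact (ih _ (by omega) hT hM hc rfl).leaf ((hT.change_root hs'.mem).rootBound hM hc) hs'
        (by omega)
    · have hT : RootedTree G x (insert s W') := .attach hW' hs
      have hc : (insert s W').card = a + b + 1 := by omega
      exact (ih _ (by omega) hT hM hc rfl).leaf ((hT.change_root hv.mem).rootBound hM hc) hv
        (by omega)
  · have c1 := Finset.card_insert_of_notMem hv.notMem
    have c2 := Finset.card_insert_of_notMem hu.notMem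
    have hT := hW'.change_root hu.mem
    rcases b with _ | b
    · have hpos := Finset.card_pos.2 ⟨w, hu.mem⟩
      obtain ⟨a, rfl⟩ : ∃ a', a = a' + 2 := ⟨a - 2, by omega⟩
      have hc : W'.card = a + 1 := by omega
      rcases Nat.eq_zero_or_pos a with rfl | ha
      · obtain ⟨z, rfl⟩ := Finset.card_eq_one.1 hc
        obtain rfl := Finset.mem_singleton.1 hu.mem
        exact (totalBound_singleton G w).path_zero (rootBound_singleton G w) hc hu hv
      · have hM' := hW'.hasMatching_one (by omega)
        exact (ih _ (by omega) hW' hM' hc rfl).path_zero (hT.rootBound hM' hc) hc hu hv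
    · obtain ⟨a, rfl⟩ : ∃ a', a = a' + 1 := ⟨a - 1, by omega⟩
      have hM' := hM.of_path hv
      have hc : W'.card = a + b + 1 := by omega
      exact (ih _ (by omega) hW' hM' hc rfl).path (hT.rootBound hM' hc) hu hv

end SubtreeCount

/-! ### From subtrees and matchings as subgraphs to finite sets -/

namespace SubtreeCount
open SimpleGraph

variable {V : Type*} {G : SimpleGraph V} {W : Finset V} {x : V} {a b k : ℕ}

/-- A nontrivial tree has two leaves, so one differs from `x` and can be removed last. -/
theorem rootedTree_of_conn [DecidableEq V] (hG : G.IsAcyclic) (hW : Conn G W) (hx : x ∈ W) :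
    RootedTree G x W := by
  induction hn : W.card using Nat.strong_induction_on generalizing W with
  | _ n ih =>
  rcases W.eq_singleton_or_nontrivial hx with rfl | hnt
  · exact .root
  have hT : (G.induce (W : Set V)).IsTree := ⟨hW, hG.induce _⟩
  have : Nontrivial (W : Set V) := hnt.coe_sort
  classical
  obtain ⟨p, q, hpq, hp, hq⟩ := hT.exists_ne_and_degree_eq_one
  obtain ⟨⟨v, hvW⟩, hvx, hdeg⟩ : ∃ z : (W : Set V), z.1 ≠ x ∧
      (G.induce (W : Set V)).degree z = 1 := by
    by_cases h : p.1 = x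
    · exact ⟨q, fun h' => hpq (Subtype.ext (h.trans h'.symm)), hq⟩
    · exact ⟨p, h, hp⟩
  obtain ⟨⟨u, huW⟩, hu, huniq⟩ := degree_eq_one_iff_existsUnique_adj.1 hdeg
  have hvu : G.Adj v u := hu
  have hv : Pendant G (W.erase v) v u := by
    refine ⟨Finset.notMem_erase _ _, Finset.mem_erase.2 ⟨hvu.ne.symm, huW⟩, fun y hy => ?_⟩
    refine ⟨fun hvy => ?_, fun h => h ▸ hvu⟩
    exact congrArg Subtype.val (huniq ⟨y, Finset.mem_of_mem_erase hy⟩ hvy)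
  have hins : insert v (W.erase v) = W := Finset.insert_erase hvW
  rw [← hins] at hW ⊢
  have hc : Conn G (W.erase v) :=
    (((hv.conn_insert_iff subset_rfl).1 hW).resolve_left
      (Finset.ne_empty_of_mem hv.mem)).2
  refine .attach (ih _ ?_ hc (Finset.mem_erase.2 ⟨fun h => hvx h.symm, hx⟩) rfl) hv
  rw [← hn]
  exact Finset.card_erase_lt_of_mem hvW

lemma RootedTree.conn [DecidableEq V] (h : RootedTree G x W) : Conn G W := by
  induction h with
  | root => exact conn_singleton G x
  | attach _ hv ih => exact (hv.conn_insert_iff subset_rfl).2 (Or.inr ⟨hv.mem, ih⟩)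

lemma conn_univ_iff [Fintype V] : Conn G Finset.univ ↔ G.Connected := by
  unfold Conn
  rw [Finset.coe_univ]
  exact (induceUnivIso G).connected_iff

/-- In an acyclic graph, a connected subgraph is induced. -/
lemma adj_of_connected (hG : G.IsAcyclic) {H : G.Subgraph} (hH : H.coe.Connected) {p q : V}
    (hp : p ∈ H.verts) (hq : q ∈ H.verts) (hpq : G.Adj p q) : H.Adj p q := by
  by_contra hn
  -- If `H` lacked the edge, it would connect `p` to `q` around a bridge.
  have hb := isAcyclic_iff_forall_adj_isBridge.1 hG hpq
  rw [isBridge_iff] at hb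
  refine hb ((hH.preconnected ⟨p, hp⟩ ⟨q, hq⟩).map
    (⟨Subtype.val, ?_⟩ : H.coe →g G.deleteEdges {s(p, q)}))
  intro r s hrs
  have hrs' : H.Adj r s := hrs
  rw [deleteEdges_adj]
  refine ⟨hrs'.adj_sub, fun he => hn ?_⟩
  rcases Sym2.eq_iff.1 (Set.mem_singleton_iff.1 he) with ⟨h1, h2⟩ | ⟨h1, h2⟩
  · rwa [h1, h2] at hrs'
  · rw [h1, h2] at hrs'
    exact hrs'.symm

theorem numSubtrees_eq_connCount [Fintype V] (hG : G.IsAcyclic) :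
    numSubtrees G = connCount G Finset.univ ∅ := by
  classical
  unfold numSubtrees connCount
  rw [← Nat.card_eq_finsetCard]
  refine Nat.card_eq_of_bijective (f := fun H => ⟨H.1.verts.toFinset, ?_⟩) ⟨?_, ?_⟩
  · rw [mem_connSets]
    refine ⟨Finset.subset_univ _, Finset.empty_subset _, ?_⟩
    unfold Conn
    rw [Set.coe_toFinset]
    have hc := H.2.connected
    refine hc.mono ?_
    intro p q hpq
    exact H.1.adj_sub hpq
  · rintro ⟨H, hH⟩ ⟨K, hK⟩ hHK
    have hverts : H.verts = K.verts := by
      have := congrArg Subtype.val hHK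
      exact Set.toFinset_inj.1 this
    refine Subtype.ext (SimpleGraph.Subgraph.ext hverts ?_)
    ext p q
    constructor
    · intro h
      exact adj_of_connected hG hK.connected (hverts ▸ h.fst_mem) (hverts ▸ h.snd_mem) h.adj_sub
    · intro h
      exact adj_of_connected hG hH.connected (hverts ▸ h.fst_mem) (hverts ▸ h.snd_mem) h.adj_sub
  · rintro ⟨S, hS⟩
    refine ⟨⟨(⊤ : G.Subgraph).induce S, ?_⟩, Subtype.ext ?_⟩
    · refine ⟨?_, hG.subgraph _⟩
      have := (mem_connSets.1 hS).2.2
      unfold Conn at this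
      rw [connected_induce_iff] at this
      exact this.coe
    · simp

theorem hasMatching_univ_iff [Fintype V] : HasMatching G Finset.univ k ↔ k ≤ matchingNumber G := by
  classical
  have hbdd : BddAbove (Set.range fun M : {M : G.Subgraph // M.IsMatching} =>
      M.1.edgeSet.ncard) := by
    refine ⟨(Set.univ : Set (Sym2 V)).ncard, ?_⟩
    rintro _ ⟨M, rfl⟩
    exact Set.ncard_le_ncard (Set.subset_univ _) (Set.toFinite _)
  have hne : Nonempty {M : G.Subgraph // M.IsMatching} :=
    ⟨⟨⊥, fun v hv => absurd hv (by simp)⟩⟩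
  constructor
  · rintro ⟨M, h1, h2, h3⟩
    let H : G.Subgraph :=
      { verts := {y | ∃ e ∈ M, y ∈ e}
        Adj := fun p q => s(p, q) ∈ M
        adj_sub := fun h => (h2 _ h).1
        edge_vert := fun h => ⟨_, h, Sym2.mem_mk_left _ _⟩
        symm := ⟨fun p q h => by rwa [Sym2.eq_swap]⟩ }
    have hH : H.IsMatching := by
      rintro p ⟨e, he, q, rfl⟩
      refine ⟨q, he, fun r hr => ?_⟩
      have := h3 _ he _ hr p (Sym2.mem_mk_left _ _) (Sym2.mem_mk_left _ _)
      exact (Sym2.congr_right.1 this).symm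
    have hedge : H.edgeSet = (M : Set (Sym2 V)) := by
      ext e
      induction e with
      | _ p q => exact Iff.rfl
    refine le_trans ?_ (le_ciSup hbdd ⟨H, hH⟩)
    rwa [hedge, Set.ncard_coe_finset]
  · intro hk
    obtain ⟨⟨M, hM⟩, hmax⟩ := Nat.sSup_mem (Set.range_nonempty _) hbdd
    have hkM : k ≤ M.edgeSet.ncard := hk.trans hmax.ge
    refine ⟨M.edgeSet.toFinset, ?_, ?_, ?_⟩
    · rwa [← Set.ncard_eq_toFinset_card']
    · exact fun e he => ⟨M.edgeSet_subset (Set.mem_toFinset.1 he), fun y _ => Finset.mem_univ y⟩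
    · rintro e he f hf y ⟨p, rfl⟩ ⟨q, rfl⟩
      rw [Set.mem_toFinset, Subgraph.mem_edgeSet] at he hf
      rw [hM.eq_of_adj_left he hf]

lemma Pendant.map {V' : Type*} {G' : SimpleGraph V'} {v u : V} (h : Pendant G W v u)
    (e : G ≃g G') : Pendant G' (W.map e.toEquiv.toEmbedding) (e v) (e u) := by
  refine ⟨?_, ?_, ?_⟩
  · exact (Finset.mem_map' e.toEquiv.toEmbedding).not.2 h.notMem
  · exact (Finset.mem_map' e.toEquiv.toEmbedding).2 h.mem
  · intro y hy
    obtain ⟨z, hz, rfl⟩ := Finset.mem_map.1 hy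
    exact e.map_adj_iff.trans ((h.adj z hz).trans e.injective.eq_iff.symm)

lemma Spider.map {V' : Type*} [DecidableEq V] [DecidableEq V'] {G' : SimpleGraph V'}
    (h : Spider G x W a b) (e : G ≃g G') :
    Spider G' (e x) (W.map e.toEquiv.toEmbedding) a b := by
  induction h with
  | centre => simpa using Spider.centre
  | leaf _ hv ih =>
    rw [Finset.map_insert]
    exact .leaf ih (hv.map e)
  | path _ hu hv ih =>
    have := hv.map e
    rw [Finset.map_insert] at this ⊢
    rw [Finset.map_insert]
    exact .path ih (hu.map e) this

lemma Spider.rootedTree [DecidableEq V] (h : Spider G x W a b) : RootedTree G x W := by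
  induction h with
  | centre => exact .root
  | leaf _ hv ih => exact .attach ih hv
  | path _ hu hv ih => exact .attach (.attach ih hu) hv

end SubtreeCount

/-! ### Spiders are the pendant stars -/

namespace SubtreeCount
open SimpleGraph

section
variable {a b : ℕ}

@[simp] lemma pendantStar_adj_centre_centre (x y : Unit) :
    ¬ (pendantStar a b).Adj (.inl x) (.inl y) := by
  simp [pendantStar]

@[simp] lemma pendantStar_adj_centre_leaf (x : Unit) (i : Fin a) :
    (pendantStar a b).Adj (.inl x) (.inr (.inl i)) := by
  simp [pendantStar]

@[simp] lemma pendantStar_adj_leaf_centre (x : Unit) (i : Fin a) :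
    (pendantStar a b).Adj (.inr (.inl i)) (.inl x) := by
  simp [pendantStar]

@[simp] lemma pendantStar_adj_centre_end (x : Unit) (j : Fin b) :
    ¬ (pendantStar a b).Adj (.inl x) (.inr (.inr j)) := by
  simp [pendantStar]

@[simp] lemma pendantStar_adj_end_centre (x : Unit) (j : Fin b) :
    ¬ (pendantStar a b).Adj (.inr (.inr j)) (.inl x) := by
  simp [pendantStar]

@[simp] lemma pendantStar_adj_leaf_leaf (i i' : Fin a) :
    ¬ (pendantStar a b).Adj (.inr (.inl i)) (.inr (.inl i')) := by
  simp [pendantStar]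

@[simp] lemma pendantStar_adj_end_end (j j' : Fin b) :
    ¬ (pendantStar a b).Adj (.inr (.inr j)) (.inr (.inr j')) := by
  simp [pendantStar]

@[simp] lemma pendantStar_adj_leaf_end (i : Fin a) (j : Fin b) :
    (pendantStar a b).Adj (.inr (.inl i)) (.inr (.inr j)) ↔ (i : ℕ) = j := by
  simp [pendantStar]

@[simp] lemma pendantStar_adj_end_leaf (i : Fin a) (j : Fin b) :
    (pendantStar a b).Adj (.inr (.inr j)) (.inr (.inl i)) ↔ (i : ℕ) = j := by
  simp [pendantStar]

/-- The centre of `pendantStar a b` with its first `k` legs of length two and its first `c` legs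
of length one. -/
def partialStar (a b k c : ℕ) : Finset (Unit ⊕ (Fin a ⊕ Fin b)) :=
  Finset.univ.disjSum
    ((Finset.univ.filter fun i : Fin a => (i : ℕ) < k ∨ (b ≤ (i : ℕ) ∧ (i : ℕ) < b + c)).disjSum
      (Finset.univ.filter fun j : Fin b => (j : ℕ) < k))

variable {k c : ℕ}

@[simp] lemma centre_mem_partialStar (x : Unit) : .inl x ∈ partialStar a b k c := by
  simp [partialStar]

@[simp] lemma leaf_mem_partialStar (i : Fin a) : .inr (.inl i) ∈ partialStar a b k c ↔
    (i : ℕ) < k ∨ (b ≤ (i : ℕ) ∧ (i : ℕ) < b + c) := by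
  simp [partialStar]

@[simp] lemma end_mem_partialStar (j : Fin b) :
    .inr (.inr j) ∈ partialStar a b k c ↔ (j : ℕ) < k := by
  simp [partialStar]

lemma partialStar_zero (a b : ℕ) : partialStar a b 0 0 = {.inl ()} := by
  ext (x | i | j)
  · simp
  · simp
  · simp

lemma partialStar_eq_univ (h : b ≤ a) : partialStar a b b (a - b) = Finset.univ := by
  ext (x | i | j)
  · simp
  · have := i.2
    simp only [leaf_mem_partialStar, Finset.mem_univ, iff_true]
    omega
  · simp

lemma pendant_single (hc : b + c < a) (hk : k ≤ b) :
    Pendant (pendantStar a b) (partialStar a b k c) (.inr (.inl ⟨b + c, hc⟩)) (.inl ()) := by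
  refine ⟨?_, by simp, ?_⟩
  · simp only [leaf_mem_partialStar]
    omega
  · rintro (x | i | j) hy
    · simp
    · simp
    · rw [end_mem_partialStar] at hy
      simp only [pendantStar_adj_leaf_end, reduceCtorEq, iff_false]
      omega

lemma insert_single (hc : b + c < a) :
    insert (.inr (.inl ⟨b + c, hc⟩)) (partialStar a b k c) = partialStar a b k (c + 1) := by
  ext (x | i | j)
  · simp
  · simp only [Finset.mem_insert, leaf_mem_partialStar, Sum.inr.injEq, Sum.inl.injEq, Fin.ext_iff]
    omega
  · simp

lemma pendant_inner (hk : k < b) (hb : b ≤ a) :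
    Pendant (pendantStar a b) (partialStar a b k c) (.inr (.inl ⟨k, hk.trans_le hb⟩))
      (.inl ()) := by
  refine ⟨?_, by simp, ?_⟩
  · simp only [leaf_mem_partialStar]
    omega
  · rintro (x | i | j) hy
    · simp
    · simp
    · rw [end_mem_partialStar] at hy
      simp only [pendantStar_adj_leaf_end, reduceCtorEq, iff_false]
      omega

lemma pendant_end (hk : k < b) (hb : b ≤ a) :
    Pendant (pendantStar a b) (insert (.inr (.inl ⟨k, hk.trans_le hb⟩)) (partialStar a b k c))
      (.inr (.inr ⟨k, hk⟩)) (.inr (.inl ⟨k, hk.trans_le hb⟩)) := by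
  refine ⟨by simp, by simp, ?_⟩
  rintro (x | i | j) hy
  · simp
  · simp [Fin.ext_iff]
  · simp

lemma insert_path (hk : k < b) (hb : b ≤ a) :
    insert (.inr (.inr ⟨k, hk⟩)) (insert (.inr (.inl ⟨k, hk.trans_le hb⟩)) (partialStar a b k c)) =
      partialStar a b (k + 1) c := by
  ext (x | i | j)
  · simp
  · simp only [Finset.mem_insert, leaf_mem_partialStar, Sum.inr.injEq, Sum.inl.injEq, Fin.ext_iff,
      reduceCtorEq, false_or]
    omega
  · simp only [Finset.mem_insert, end_mem_partialStar, Sum.inr.injEq, Fin.ext_iff, reduceCtorEq,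
      false_or]
    omega

lemma spider_partialStar (hb : b ≤ a) (hk : k ≤ b) (hc : b + c ≤ a) :
    Spider (pendantStar a b) (.inl ()) (partialStar a b k c) (k + c) k := by
  induction c with
  | zero =>
    induction k with
    | zero =>
      rw [partialStar_zero]
      exact .centre
    | succ k ih =>
      rw [← insert_path hk hb, show k + 1 + 0 = k + 0 + 1 by omega]
      exact .path (ih (by omega)) (pendant_inner hk hb) (pendant_end hk hb)
  | succ c ih =>
    rw [← insert_single hc]
    exact .leaf (ih (by omega)) (pendant_single hc hk)

theorem spider_pendantStar (hb : b ≤ a) :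
    Spider (pendantStar a b) (.inl ()) Finset.univ a b := by
  have := spider_partialStar (c := a - b) hb le_rfl (by omega)
  rwa [partialStar_eq_univ hb, show b + (a - b) = a by omega] at this

end

section
variable {V V' : Type*} {G : SimpleGraph V} {H : SimpleGraph V'} {W : Finset V} {U : Finset V'}

/-- The map `f` restricts to an isomorphism from the subgraph of `H` induced by `U` to the
subgraph of `G` induced by `W`. -/
structure IsIsoOn (H : SimpleGraph V') (U : Finset V') (G : SimpleGraph V) (W : Finset V)
    (f : V' → V) : Prop where
  bijOn : Set.BijOn f U W
  adj : ∀ p ∈ U, ∀ q ∈ U, G.Adj (f p) (f q) ↔ H.Adj p q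

lemma IsIsoOn.insert [DecidableEq V] [DecidableEq V'] {f : V' → V} {p q : V'} {v : V}
    (h : IsIsoOn H U G W f) (hp : Pendant H U p q) (hv : Pendant G W v (f q)) :
    IsIsoOn H (insert p U) G (insert v W) (Function.update f p v) := by
  have hf : ∀ r ∈ U, Function.update f p v r = f r := by
    intro r hr
    refine Function.update_of_ne ?_ _ _
    rintro rfl
    exact hp.notMem hr
  have hpf : Function.update f p v p = v := Function.update_self ..
  have hadj : ∀ r ∈ U, G.Adj v (f r) ↔ H.Adj p r := fun r hr =>
    (hv.adj _ (h.bijOn.mapsTo hr)).trans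
      ((h.bijOn.injOn.eq_iff hr hp.mem).trans (hp.adj r hr).symm)
  constructor
  · have := (h.bijOn.congr fun r hr => (hf r hr).symm).insert (a := p)
      (by rw [hpf]; exact hv.notMem)
    rw [hpf] at this
    simpa using this
  · intro r hr s hs
    rcases Finset.mem_insert.1 hr with rfl | hr' <;> rcases Finset.mem_insert.1 hs with rfl | hs'
    · simp
    · rw [hpf, hf s hs', hadj s hs']
    · rw [hpf, hf r hr', G.adj_comm, hadj r hr', H.adj_comm]
    · rw [hf r hr', hf s hs', h.adj r hr' s hs']

/-- Long legs take the indices below `b` and short legs those from `b` on, so the two kinds may be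
attached in any order. -/
lemma Spider.exists_isIsoOn [DecidableEq V] {x : V} {a b k c : ℕ} (h : Spider G x W (k + c) k)
    (hb : b ≤ a) (hk : k ≤ b) (hc : b + c ≤ a) :
    ∃ f, IsIsoOn (pendantStar a b) (partialStar a b k c) G W f ∧ f (.inl ()) = x := by
  generalize hm : k + c = m at h
  induction h generalizing c with
  | centre =>
    obtain rfl : c = 0 := by omega
    refine ⟨fun _ => x, ⟨?_, ?_⟩, rfl⟩
    · rw [partialStar_zero]
      simp
    · rw [partialStar_zero]
      simp
  | @leaf W m k v hW hv ih =>
    have := hW.le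
    obtain ⟨c, rfl⟩ : ∃ c', c = c' + 1 := ⟨c - 1, by omega⟩
    obtain ⟨f, hf, rfl⟩ := ih (c := c) hk (by omega) (by omega)
    rw [← insert_single hc]
    exact ⟨_, hf.insert (pendant_single hc hk) hv, Function.update_of_ne (by simp) _ _⟩
  | @path W m k u v hW hu hv ih =>
    obtain ⟨f, hf, rfl⟩ := ih (c := c) (by omega) hc (by omega)
    rw [← insert_path hk hb]
    refine ⟨_, (hf.insert (pendant_inner hk hb) hu).insert (pendant_end hk hb) ?_, ?_⟩
    · rwa [Function.update_self]
    · rw [Function.update_of_ne (by simp), Function.update_of_ne (by simp)]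

theorem Spider.nonempty_iso [Fintype V] [DecidableEq V] {x : V} {a b : ℕ}
    (h : Spider G x Finset.univ a b) : Nonempty (G ≃g pendantStar a b) := by
  have hb := h.le
  have h' : Spider G x Finset.univ (b + (a - b)) b := by rwa [show b + (a - b) = a by omega]
  obtain ⟨f, hf, -⟩ := h'.exists_isIsoOn hb le_rfl (by omega)
  rw [partialStar_eq_univ hb] at hf
  have hbij : Function.Bijective f := by
    rw [← Set.bijOn_univ]
    simpa using hf.bijOn
  exact ⟨(⟨Equiv.ofBijective f hbij, fun {p q} => hf.adj p (Finset.mem_univ _) q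
    (Finset.mem_univ _)⟩ : pendantStar a b ≃g G).symm⟩

theorem Spider.of_iso [Fintype V] [DecidableEq V] {a b : ℕ} (e : G ≃g pendantStar a b)
    (hb : b ≤ a) : Spider G (e.symm (.inl ())) Finset.univ a b := by
  simpa using (spider_pendantStar hb).map e.symm

end

end SubtreeCount

/-! ### Degrees of the pendant star -/

namespace SubtreeCount
open SimpleGraph

section
variable {a b : ℕ}

lemma ncard_neighborSet_centre (x : Unit) : ((pendantStar a b).neighborSet (.inl x)).ncard = a := by
  have : (pendantStar a b).neighborSet (.inl x) =
      (fun i : Fin a => (.inr (.inl i) : Unit ⊕ (Fin a ⊕ Fin b))) '' Set.univ := by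
    ext (y | i | j) <;> simp
  rw [this, Set.ncard_image_of_injective _ (fun i j h => by simpa using h), Set.ncard_univ,
    Nat.card_eq_fintype_card, Fintype.card_fin]

lemma ncard_neighborSet_leaf (i : Fin a) :
    ((pendantStar a b).neighborSet (.inr (.inl i))).ncard = if (i : ℕ) < b then 2 else 1 := by
  split_ifs with h
  · have : (pendantStar a b).neighborSet (.inr (.inl i)) = {.inl (), .inr (.inr ⟨i, h⟩)} := by
      ext (y | i' | j)
      · simp
      · simp
      · simp [Fin.ext_iff, eq_comm]
    rw [this, Set.ncard_pair (by simp)]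
  · have : (pendantStar a b).neighborSet (.inr (.inl i)) = {.inl ()} := by
      ext (y | i' | j)
      · simp
      · simp
      · have := j.2
        simp only [mem_neighborSet, pendantStar_adj_leaf_end, Set.mem_singleton_iff, reduceCtorEq,
          iff_false]
        omega
    rw [this, Set.ncard_singleton]

lemma ncard_neighborSet_end (hb : b ≤ a) (j : Fin b) :
    ((pendantStar a b).neighborSet (.inr (.inr j))).ncard = 1 := by
  have : (pendantStar a b).neighborSet (.inr (.inr j)) = {.inr (.inl ⟨j, j.2.trans_le hb⟩)} := by
    ext (y | i | j')
    · simp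
    · simp [Fin.ext_iff]
    · simp
  rw [this, Set.ncard_singleton]

lemma map_univ_sum {α β γ : Type*} [Fintype α] [Fintype β] (f : α ⊕ β → γ) :
    (Finset.univ : Finset (α ⊕ β)).val.map f =
      (Finset.univ : Finset α).val.map (f ∘ Sum.inl) +
        (Finset.univ : Finset β).val.map (f ∘ Sum.inr) := by
  rw [← Finset.univ_disjSum_univ, Finset.val_disjSum, Multiset.disjSum, Multiset.map_add,
    Multiset.map_map, Multiset.map_map]

lemma map_degree_leaves (hb : b ≤ a) :
    (Finset.univ : Finset (Fin a)).val.map (fun i : Fin a => if (i : ℕ) < b then 2 else 1) =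
      Multiset.replicate b 2 + Multiset.replicate (a - b) 1 := by
  obtain ⟨c, rfl⟩ := Nat.exists_eq_add_of_le hb
  rw [← Multiset.map_univ_val_equiv finSumFinEquiv, Multiset.map_map, map_univ_sum,
    Nat.add_sub_cancel_left]
  congr 1
  · rw [Multiset.map_congr rfl (g := fun _ => 2) (fun i _ => by simp), Multiset.map_const']
    simp
  · rw [Multiset.map_congr rfl (g := fun _ => 1) (fun i _ => by simp), Multiset.map_const']
    simp

/-- The degree sequence of `pendantStar a b`, as a multiset. -/
lemma map_degree_pendantStar (hb : b ≤ a) :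
    (Finset.univ : Finset (Unit ⊕ (Fin a ⊕ Fin b))).val.map
        (fun v => ((pendantStar a b).neighborSet v).ncard) =
      (a :: (List.replicate b 2 ++ List.replicate a 1) : List ℕ) := by
  have h0 : (fun v => ((pendantStar a b).neighborSet v).ncard) ∘ Sum.inl = fun _ => a :=
    funext ncard_neighborSet_centre
  have h1 : ((fun v => ((pendantStar a b).neighborSet v).ncard) ∘ Sum.inr) ∘ Sum.inl =
      fun i : Fin a => if (i : ℕ) < b then 2 else 1 := funext ncard_neighborSet_leaf
  have h2 : ((fun v => ((pendantStar a b).neighborSet v).ncard) ∘ Sum.inr) ∘ Sum.inr =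
      fun _ : Fin b => 1 := funext (ncard_neighborSet_end hb)
  rw [map_univ_sum, map_univ_sum, h0, h1, h2,
    map_degree_leaves hb, Multiset.map_const', Multiset.map_const', ← Multiset.cons_coe,
    ← Multiset.coe_add, Multiset.coe_replicate, Multiset.coe_replicate, add_assoc,
    ← Multiset.replicate_add]
  simp only [Finset.card_val, Finset.card_univ, Fintype.card_fin, Fintype.card_unit,
    Nat.sub_add_cancel hb]
  simp

end

lemma degreeSequence_congr {V V' : Type*} [Fintype V] [Fintype V'] {G : SimpleGraph V}
    {H : SimpleGraph V'} (e : G ≃g H) : degreeSequence G = degreeSequence H := by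
  unfold degreeSequence
  congr 1
  rw [← Finset.map_univ_equiv e.toEquiv, Finset.map_val, Multiset.map_map]
  refine Multiset.map_congr rfl fun v _ => ?_
  exact Nat.card_congr (e.mapNeighborSet v)

/-- It is connected, and its degree sum `2 * (a + b)` gives one edge fewer than vertices. -/
lemma isTree_pendantStar {a b : ℕ} (hb : b ≤ a) : (pendantStar a b).IsTree := by
  classical
  rw [isTree_iff_connected_and_card]
  refine ⟨conn_univ_iff.1 (spider_pendantStar hb).rootedTree.conn, ?_⟩
  have hsum := (pendantStar a b).sum_degrees_eq_twice_card_edges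
  have hdeg : ∑ v, (pendantStar a b).degree v =
      (a :: (List.replicate b 2 ++ List.replicate a 1) : List ℕ).sum := by
    rw [← Multiset.sum_coe, ← map_degree_pendantStar hb]
    refine Finset.sum_congr rfl fun v _ => ?_
    rw [← card_neighborSet_eq_degree, ← Nat.card_eq_fintype_card]
    rfl
  rw [hdeg] at hsum
  simp at hsum
  rw [Nat.card_eq_fintype_card, ← edgeFinset_card]
  simp
  omega

/-- Strictness makes the list sorted: if a two occurs, then `a` is at least two. -/
lemma degreeSequence_pendantStar {a b : ℕ} (hb : b < a) :
    degreeSequence (pendantStar a b) = a :: (List.replicate b 2 ++ List.replicate a 1) := by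
  unfold degreeSequence
  rw [map_degree_pendantStar hb.le, Multiset.coe_sort]
  apply List.mergeSort_of_pairwise
  simp only [List.pairwise_cons, List.pairwise_append, List.pairwise_replicate, List.mem_append,
    List.mem_replicate, decide_eq_true_eq]
  refine ⟨?_, by simp, by simp, ?_⟩
  · rintro m (⟨h, rfl⟩ | ⟨h, rfl⟩) <;> omega
  · rintro m ⟨-, rfl⟩ m' ⟨-, rfl⟩
    omega

/-! ### The breadth-first tree -/

section
variable {a b : ℕ}

lemma bfsChildren_zero (a b : ℕ) :
    bfsChildren (a :: (List.replicate b 2 ++ List.replicate a 1)) 0 = a := by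
  simp [bfsChildren]

lemma bfsChildren_succ (a b k : ℕ) :
    bfsChildren (a :: (List.replicate b 2 ++ List.replicate a 1)) (k + 1) =
      if k < b then 1 else 0 := by
  have h : (List.replicate b 2 ++ List.replicate a 1).getD k 0 - 1 = if k < b then 1 else 0 := by
    rw [List.getD_eq_getElem?_getD, List.getElem?_append, List.length_replicate]
    split_ifs with hk
    · simp [hk]
    -- Past the end of the list the default 0 gives `0 - 1 = 0`, the same value as for a leaf.
    · rw [List.getElem?_replicate]
      split_ifs <;> simp
  simpa [bfsChildren] using h

lemma sum_bfsChildren (a b i : ℕ) :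
    ∑ k ∈ Finset.range (i + 1),
      bfsChildren (a :: (List.replicate b 2 ++ List.replicate a 1)) k = a + min i b := by
  induction i with
  | zero => simp [bfsChildren_zero]
  | succ i ih =>
    rw [Finset.sum_range_succ, ih, bfsChildren_succ]
    split_ifs <;> omega

lemma isBfsChild_iff (a b i j : ℕ) :
    IsBfsChild (a :: (List.replicate b 2 ++ List.replicate a 1)) i j ↔
      (i = 0 ∧ 1 ≤ j ∧ j ≤ a) ∨ (1 ≤ i ∧ i ≤ b ∧ j = a + i) := by
  unfold IsBfsChild
  rw [sum_bfsChildren]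
  rcases i with _ | i
  · simp
    omega
  · rw [sum_bfsChildren]
    omega

/-- The place of a vertex of `pendantStar a b` in the breadth-first order. -/
def bfsIndex (a b : ℕ) (z : Unit ⊕ (Fin a ⊕ Fin b)) :
    Fin (a :: (List.replicate b 2 ++ List.replicate a 1)).length :=
  ⟨match z with
    | .inl _ => 0
    | .inr (.inl i) => 1 + i
    | .inr (.inr j) => 1 + a + j, by
    rcases z with _ | i | j <;> simp <;> omega⟩

lemma bfsIndex_bijective (a b : ℕ) : Function.Bijective (bfsIndex a b) := by
  rw [Fintype.bijective_iff_injective_and_card]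
  constructor
  · rintro (x | i | j) (x' | i' | j') h <;> simp [bfsIndex, Fin.ext_iff] at h ⊢ <;> omega
  · simp
    omega

lemma bfsTree_adj_bfsIndex (hb : b ≤ a) (p q : Unit ⊕ (Fin a ⊕ Fin b)) :
    (bfsTree (a :: (List.replicate b 2 ++ List.replicate a 1))).Adj
      (bfsIndex a b p) (bfsIndex a b q) ↔ (pendantStar a b).Adj p q := by
  simp only [bfsTree, fromRel_adj, isBfsChild_iff, ne_eq, (bfsIndex_bijective a b).1.eq_iff]
  rcases p with x | i | j <;> rcases q with x' | i' | j' <;> simp [bfsIndex] <;> omega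

theorem nonempty_bfsTree_iso (hb : b ≤ a) :
    Nonempty (bfsTree (a :: (List.replicate b 2 ++ List.replicate a 1)) ≃g pendantStar a b) :=
  ⟨(⟨Equiv.ofBijective _ (bfsIndex_bijective a b), fun {p q} => bfsTree_adj_bfsIndex hb p q⟩ :
    pendantStar a b ≃g _).symm⟩

end

/-! ### Extremality and uniqueness -/

section
variable {V : Type*} {T : SimpleGraph V} {a b : ℕ}

lemma isTree_of_iso (e : T ≃g pendantStar a b) (hb : b ≤ a) : T.IsTree :=
  e.isTree_iff.2 (isTree_pendantStar hb)

variable [Fintype V]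

lemma numSubtrees_of_iso (e : T ≃g pendantStar a b) (hb : b ≤ a) :
    numSubtrees T = 2 ^ (a - b) * 3 ^ b + (a + 2 * b) := by
  classical
  rw [numSubtrees_eq_connCount (isTree_of_iso e hb).isAcyclic, (Spider.of_iso e hb).connCount_empty]

lemma totalBound_univ [DecidableEq V] (hT : T.IsTree) (hM : b + 1 ≤ matchingNumber T)
    (hcard : Fintype.card V = a + b + 1) : TotalBound T Finset.univ a b := by
  obtain ⟨x⟩ := hT.connected.nonempty
  exact (rootedTree_of_conn hT.isAcyclic (conn_univ_iff.2 hT.connected)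
    (Finset.mem_univ x)).totalBound (hasMatching_univ_iff.2 hM) hcard

lemma matchingNumber_of_iso (e : T ≃g pendantStar a b) (hb : b < a) :
    matchingNumber T = b + 1 := by
  classical
  have hS := Spider.of_iso e hb.le
  have hcard : Fintype.card V = a + b + 1 := hS.card
  refine le_antisymm ?_ (hasMatching_univ_iff.1 (hS.hasMatching.2 hb))
  -- A larger matching would allow `totalBound_univ` with `(a - 1, b + 1)` in place of `(a, b)`; its
  -- main term is 6 parts against 8 for the actual count, too small even after the linear term rises
  -- by one.
  by_contra! h
  have h2 : b + 1 + 1 ≤ matchingNumber T := h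
  obtain ⟨a, rfl⟩ : ∃ a', a = a' + 1 := ⟨a - 1, by omega⟩
  have hcard' : Fintype.card V = a + (b + 1) + 1 := by omega
  have hlt := HasMatching.lt (hasMatching_univ_iff.2 h2) hcard'
  have hle := (totalBound_univ (isTree_of_iso e hb.le) h2 hcard').1
  obtain ⟨c, rfl⟩ : ∃ c, a = b + 2 + c := ⟨a - (b + 2), by omega⟩
  rw [hS.connCount_empty, show b + 2 + c + 1 - b = c + 3 by omega,
    show b + 2 + c - (b + 1) = c + 1 by omega] at hle
  have hpos : 0 < 2 ^ c * 3 ^ b := by positivity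
  have e1 : 2 ^ (c + 3) * 3 ^ b = 8 * (2 ^ c * 3 ^ b) := by ring
  have e2 : 2 ^ (c + 1) * 3 ^ (b + 1) = 6 * (2 ^ c * 3 ^ b) := by ring
  omega

lemma isTreeWithMatchingNumber_of_iso (e : T ≃g pendantStar a b) (hb : b < a) :
    IsTreeWithMatchingNumber (a + b + 1) (b + 1) T := by
  classical
  refine ⟨?_, isTree_of_iso e hb.le, matchingNumber_of_iso e hb⟩
  rw [Nat.card_eq_fintype_card]
  exact (Spider.of_iso e hb.le).card

theorem numSubtrees_le (hT : IsTreeWithMatchingNumber (a + b + 1) (b + 1) T) :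
    numSubtrees T ≤ 2 ^ (a - b) * 3 ^ b + (a + 2 * b) ∧
      (numSubtrees T = 2 ^ (a - b) * 3 ^ b + (a + 2 * b) → Nonempty (T ≃g pendantStar a b)) := by
  classical
  obtain ⟨h1, h2, h3⟩ := hT
  rw [Nat.card_eq_fintype_card] at h1
  have := totalBound_univ h2 h3.ge h1
  rw [numSubtrees_eq_connCount h2.isAcyclic]
  exact ⟨this.1, fun h => (this.2 h).elim fun x hx => hx.nonempty_iso⟩

lemma matchingNumber_bounds (hT : T.IsTree) (hV : 2 ≤ Fintype.card V) :
    1 ≤ matchingNumber T ∧ 2 * matchingNumber T ≤ Fintype.card V := by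
  classical
  obtain ⟨x⟩ := hT.connected.nonempty
  have := rootedTree_of_conn hT.isAcyclic (conn_univ_iff.2 hT.connected) (Finset.mem_univ x)
  exact ⟨hasMatching_univ_iff.1 (this.hasMatching_one hV),
    (hasMatching_univ_iff.2 le_rfl).two_mul_le_card⟩

theorem isOptimal_iff (hb : b < a) (hT : IsTreeWithMatchingNumber (a + b + 1) (b + 1) T) :
    IsOptimal (a + b + 1) (b + 1) T ↔ Nonempty (T ≃g pendantStar a b) := by
  constructor
  · rintro ⟨-, hmax⟩
    have hcard : Fintype.card (Unit ⊕ (Fin a ⊕ Fin b)) = Fintype.card V := by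
      rw [← Nat.card_eq_fintype_card (α := V), hT.1]
      simp
      omega
    -- `IsOptimal` compares only trees on `V`, so the star is transported there as a competitor.
    let f := Fintype.equivOfCardEq hcard
    let e : (pendantStar a b).map f.toEmbedding ≃g pendantStar a b := (Iso.map f _).symm
    have := hmax _ (isTreeWithMatchingNumber_of_iso e hb)
    rw [numSubtrees_of_iso e hb.le] at this
    exact (numSubtrees_le hT).2 ((numSubtrees_le hT).1.antisymm this)
  · rintro ⟨e⟩
    refine ⟨hT, fun T' hT' => ?_⟩
    rw [numSubtrees_of_iso e hb.le]
    exact (numSubtrees_le hT').1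

end

end SubtreeCount

theorem corollary5p5 (n β : ℕ) (hn : 2 ≤ n) :
    (1 ≤ β → 2 * β ≤ n →
      IsTreeWithMatchingNumber n β (bfsTree (matchingDegrees n β)) ∧
      degreeSequence (bfsTree (matchingDegrees n β)) = matchingDegrees n β ∧
      Nonempty (bfsTree (matchingDegrees n β) ≃g pendantStar (n - β) (β - 1)) ∧
      numSubtrees (bfsTree (matchingDegrees n β)) =
        2 ^ (n - 2 * β + 1) * 3 ^ (β - 1) + (n + β - 2)) ∧
    ∀ {V : Type*} (T : SimpleGraph V), IsTreeWithMatchingNumber n β T →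
      (1 ≤ β ∧ 2 * β ≤ n) ∧
      numSubtrees T ≤ 2 ^ (n - 2 * β + 1) * 3 ^ (β - 1) + (n + β - 2) ∧
      (numSubtrees T = 2 ^ (n - 2 * β + 1) * 3 ^ (β - 1) + (n + β - 2) ↔
        Nonempty (T ≃g bfsTree (matchingDegrees n β))) ∧
      (IsOptimal n β T ↔ Nonempty (T ≃g bfsTree (matchingDegrees n β))) := by
  -- In terms of `a = n - β` and `b = β - 1`, the condition `2 * β ≤ n` is `b < a`.
  have params : 1 ≤ β → 2 * β ≤ n → ∃ a b, b < a ∧ n = a + b + 1 ∧ β = b + 1 :=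
    fun h1 h2 => ⟨n - β, β - 1, by omega, by omega, by omega⟩
  have pow_eq : ∀ a b : ℕ, b < a → 2 ^ (a + b + 1 - 2 * (b + 1) + 1) * 3 ^ (b + 1 - 1) +
      (a + b + 1 + (b + 1) - 2) = 2 ^ (a - b) * 3 ^ b + (a + 2 * b) := by
    intro a b hb
    rw [show a + b + 1 - 2 * (b + 1) + 1 = a - b by omega, show b + 1 - 1 = b by omega,
      show a + b + 1 + (b + 1) - 2 = a + 2 * b by omega]
  have degrees_eq : ∀ a b : ℕ, matchingDegrees (a + b + 1) (b + 1) =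
      a :: (List.replicate b 2 ++ List.replicate a 1) := by
    intro a b
    rw [matchingDegrees, show a + b + 1 - (b + 1) = a by omega, Nat.add_sub_cancel]
  constructor
  · intro h1 h2
    obtain ⟨a, b, hb, rfl, rfl⟩ := params h1 h2
    rw [pow_eq a b hb, degrees_eq, show a + b + 1 - (b + 1) = a by omega, Nat.add_sub_cancel]
    obtain ⟨e⟩ := SubtreeCount.nonempty_bfsTree_iso hb.le
    exact ⟨SubtreeCount.isTreeWithMatchingNumber_of_iso e hb,
      (SubtreeCount.degreeSequence_congr e).trans (SubtreeCount.degreeSequence_pendantStar hb),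
      ⟨e⟩, SubtreeCount.numSubtrees_of_iso e hb.le⟩
  · intro V T hT
    have hfin : Finite V := Nat.finite_of_card_ne_zero (by rw [hT.1]; omega)
    have := Fintype.ofFinite V
    have hβ : 1 ≤ β ∧ 2 * β ≤ n := by
      have hcard : Fintype.card V = n := by rw [← Nat.card_eq_fintype_card, hT.1]
      have := SubtreeCount.matchingNumber_bounds hT.2.1 (by omega)
      rwa [hT.2.2, hcard] at this
    refine ⟨hβ, ?_⟩
    obtain ⟨a, b, hb, rfl, rfl⟩ := params hβ.1 hβ.2
    rw [pow_eq a b hb, degrees_eq, SubtreeCount.isOptimal_iff hb hT]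
    obtain ⟨e⟩ := SubtreeCount.nonempty_bfsTree_iso hb.le
    have hiso : Nonempty (T ≃g pendantStar a b) ↔ Nonempty (T ≃g bfsTree _) :=
      ⟨fun ⟨f⟩ => ⟨f.trans e.symm⟩, fun ⟨f⟩ => ⟨f.trans e⟩⟩
    obtain ⟨hle, heq⟩ := SubtreeCount.numSubtrees_le hT
    exact ⟨hle, ⟨fun h => hiso.1 (heq h),
      fun h => (hiso.2 h).elim fun f => SubtreeCount.numSubtrees_of_iso f hb.le⟩, hiso⟩
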